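/- Let $X$ be a compact complex manifold of pure dimension $n$ with canonical bundle $K_X$, and let $A$ be a holomorphic line bundle on $X$ (for instance, $X$ a smooth projective variety with pseudoeffective $K_X$ and $A$ sufficiently ample). For a $C^\infty$ hermitian metric $h_A$ on $A$ and an integer $m\ge 1$ put $$\hat K_m^A(x):=\sup\Big\{|\sigma|^{2/m}(x)\ :\ \sigma\in\Gamma(X,\mathcal O_X(A+mK_X)),\ \Big|\int_X h_A^{1/m}\cdot(\sigma\wedge\bar\sigma)^{1/m}\Big|=1\Big\}\qquad(x\in X),$$ the supremum being taken in the fibre at $x$ of the real line bundle $|A|^{2/m}\otimes|K_X|^2$ (it is $0$ if there is no such $\sigma$). Here, if locally $\sigma=f\,e_A\otimes(dz_1\wedge\dots\wedge dz_n)^{\otimes m}$ with a local holomorphic frame $e_A$ of $A$ and local coordinates $z$, then $|\sigma|^{2/m}$ has the coefficient $|f|^{2/m}$, and $|h_A^{1/m}(\sigma\wedge\bar\sigma)^{1/m}|$ is the semipositive $(n,n)$-form $h_A(e_A,e_A)^{1/m}|f|^{2/m}\,|dz\wedge d\bar z|$ with $dz=dz_1\wedge\dots\wedge dz_n$. Thus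 $h_A^{1/m}\cdot\hat K_m^A$ is a semipositive $(n,n)$-form (a section of $|K_X|^2$). Put $$\hat K_\infty^A:=\limsup_{m\to\infty}h_A^{1/m}\cdot\hat K_m^A\quad\text{(pointwise)},\qquad \hat h_{can,A}:=\text{the lower semicontinuous envelope of }(\hat K_\infty^A)^{-1},$$ the latter a singular hermitian metric on $K_X$, with values in $[0,\infty]$ and $0^{-1}=\infty$. Then $\hat K_\infty^A$ does not depend on the choice of the $C^\infty$ hermitian metric $h_A$ on $A$: any two such metrics give the same $\hat K_\infty^A$ at every point of $X$. Hence $\hat h_{can,A}$ does not depend on the choice of $h_A$ either. -/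

import Mathlib

open Bundle Filter Topology MeasureTheory
open scoped Manifold ContDiff ENNReal TensorProduct

noncomputable section

namespace Supercanonical

/-- The model space `ℂⁿ` of complex `n`-folds. -/
abbrev Model (n : ℕ) : Type := Fin n → ℂ

section Canonical

variable {n : ℕ} {X : Type*} [TopologicalSpace X] [ChartedSpace (Model n) X]

/-- The holomorphic tangent space `T_x X` of the complex manifold `X`. -/
abbrev Tan (n : ℕ) {X : Type*} [TopologicalSpace X] [ChartedSpace (Model n) X] (x : X) : Type :=
  TangentSpace 𝓘(ℂ, Model n) x

/-- The fibre at `x` of the canonical bundle `K_X = ⋀ⁿ T^*X`. -/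
abbrev CanFiber (n : ℕ) {X : Type*} [TopologicalSpace X] [ChartedSpace (Model n) X] (x : X) :
    Type :=
  (Tan n x) [⋀^Fin n]→ₗ[ℂ] ℂ

/-- The coordinate frame `(∂/∂z₁, …, ∂/∂zₙ)` at `x` of a holomorphic chart `φ = (z₁, …, zₙ)`. -/
def coordFrame (φ : OpenPartialHomeomorph X (Model n)) (x : X) : Fin n → Tan n x := fun i =>
  ContinuousLinearMap.inverse (mfderiv 𝓘(ℂ, Model n) 𝓘(ℂ, Model n) φ x) (Pi.single i (1 : ℂ))

/-- Evaluation of an `n`-form at `x` on an `n`-tuple of tangent vectors. -/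
def evalForm {x : X} (v : Fin n → Tan n x) : CanFiber n x →ₗ[ℂ] ℂ where
  toFun ξ := ξ v
  map_add' _ _ := rfl
  map_smul' _ _ := rfl

/-- Evaluation of an element of `K_{X,x}^{⊗ m}` on an `n`-tuple of tangent vectors:
`ξ₁ ⊗ ⋯ ⊗ ξ_m ↦ ξ₁(v) ⋯ ξ_m(v)`. -/
def evalPow (m : ℕ) {x : X} (v : Fin n → Tan n x) : (⨂[ℂ]^m (CanFiber n x)) →ₗ[ℂ] ℂ :=
  PiTensorProduct.lift
    ((MultilinearMap.mkPiAlgebra ℂ (Fin m) ℂ).compLinearMap fun _ => evalForm v)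

/-- A (pointwise, not necessarily continuous) semipositive `(n,n)`-form on `X` with values in
`[0, ∞]`, i.e. a section of `|K_X|²`, given through its values on `n`-tuples of tangent vectors:
`g · |ξ|²` with `ξ ∈ K_{X,x}` is the function `v ↦ g · |ξ(v)|²`. -/
abbrev Density (n : ℕ) (X : Type*) [TopologicalSpace X] [ChartedSpace (Model n) X] : Type _ :=
  ∀ x : X, (Fin n → Tan n x) → ℝ≥0∞

/-- The coefficient `g` of a semipositive `(n,n)`-form `g · |dz₁ ∧ ⋯ ∧ dzₙ|²` in the
chart `φ = (z₁, …, zₙ)`. -/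
def Density.coeff (η : Density n X) (φ : OpenPartialHomeomorph X (Model n)) (x : X) : ℝ≥0∞ :=
  η x (coordFrame φ x)

/-- The integral over `X` of a semipositive `(n,n)`-form.  It is the supremum, over all finite
families of pairwise disjoint measurable pieces that lie in chart domains, of the sums of the
integrals over the pieces; in a chart, `|dz ∧ dz̄|` (with `dz = dz₁ ∧ ⋯ ∧ dzₙ`) is `2ⁿ` times
Lebesgue measure.  (On a compact `X` the supremum is attained by every decomposition of `X` into
such pieces.) -/
def Density.integral (η : Density n X) : ℝ≥0∞ :=
  ⨆ (N : ℕ) (φ : Fin N → OpenPartialHomeomorph X (Model n)) (S : Fin N → Set X)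
    (_ : ∀ i, φ i ∈ atlas (Model n) X ∧ S i ⊆ (φ i).source ∧ MeasurableSet (φ i '' S i))
    (_ : Pairwise fun i j => Disjoint (S i) (S j)),
    ∑ i, ∫⁻ z in φ i '' S i, 2 ^ n * η.coeff (φ i) ((φ i).symm z)

end Canonical

section LineBundle

variable {n : ℕ} {X : Type*} [TopologicalSpace X] [ChartedSpace (Model n) X]
  (A : X → Type*) [TopologicalSpace (TotalSpace ℂ A)] [∀ x, AddCommGroup (A x)]
  [∀ x, Module ℂ (A x)] [∀ x, TopologicalSpace (A x)] [FiberBundle ℂ A]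

/-- A `C^∞` hermitian metric on the holomorphic line bundle `A`: a positive definite hermitian
form on every fibre such that `h(e, e)` is (real) `C^∞` for the frame `e` of each local
trivialization of `A`. -/
structure SmoothHermitianMetric (n : ℕ) {X : Type*} [TopologicalSpace X]
    [ChartedSpace (Model n) X] (A : X → Type*) [TopologicalSpace (TotalSpace ℂ A)]
    [∀ x, AddCommGroup (A x)] [∀ x, Module ℂ (A x)] [∀ x, TopologicalSpace (A x)]
    [FiberBundle ℂ A] where
  form : ∀ x, A x →ₗ⋆[ℂ] A x →ₗ[ℂ] ℂ
  conj_symm : ∀ x (v w : A x), starRingEnd ℂ (form x v w) = form x w v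
  pos : ∀ x (v : A x), v ≠ 0 → 0 < (form x v v).re
  smooth : ∀ (e : Trivialization ℂ (TotalSpace.proj : TotalSpace ℂ A → X))
    [MemTrivializationAtlas e],
    ContMDiffOn 𝓘(ℝ, Model n) 𝓘(ℝ, ℝ) ∞
      (fun x => (form x (e.symm x 1) (e.symm x 1)).re) e.baseSet

/-- `h(a, a)` as an element of `[0, ∞]`. -/
def SmoothHermitianMetric.sq {A} [TopologicalSpace (TotalSpace ℂ A)] [∀ x, AddCommGroup (A x)]
    [∀ x, Module ℂ (A x)] [∀ x, TopologicalSpace (A x)] [FiberBundle ℂ A]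
    (h : SmoothHermitianMetric n A) {x : X} (a : A x) : ℝ≥0∞ :=
  ENNReal.ofReal (h.form x a a).re

/-- The fibre at `x` of the line bundle `A + m K_X`, that is `A ⊗ K_X^{⊗ m}`. -/
abbrev AdjFiber (n : ℕ) {X : Type*} [TopologicalSpace X] [ChartedSpace (Model n) X]
    (A : X → Type*) [∀ x, AddCommGroup (A x)] [∀ x, Module ℂ (A x)] (m : ℕ) (x : X) : Type _ :=
  A x ⊗[ℂ] (⨂[ℂ]^m (CanFiber n x))

variable {A}

/-- Evaluation of an element of `A_x ⊗ K_{X,x}^{⊗ m}` on an `n`-tuple of tangent vectors: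
`a ⊗ ξ₁ ⊗ ⋯ ⊗ ξ_m ↦ ξ₁(v) ⋯ ξ_m(v) · a`. -/
def evalAdj (m : ℕ) {x : X} (v : Fin n → Tan n x) : AdjFiber n A m x →ₗ[ℂ] A x :=
  (TensorProduct.rid ℂ (A x)).toLinearMap ∘ₗ LinearMap.lTensor (A x) (evalPow m v)

/-- `σ ∈ Γ(X, O_X(A + m K_X))`: in every holomorphic chart `(z₁, …, zₙ)` one has
`σ = f ⊗ (dz₁ ∧ ⋯ ∧ dzₙ)^{⊗ m}` with a holomorphic local section `f` of `A`; the section `f` is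
the value of `σ` on the coordinate frame. -/
def IsHolomorphicSection (m : ℕ) (σ : ∀ x, AdjFiber n A m x) : Prop :=
  ∀ φ ∈ atlas (Model n) X,
    ContMDiffOn 𝓘(ℂ, Model n) (𝓘(ℂ, Model n).prod 𝓘(ℂ, ℂ)) ω
      (fun x => TotalSpace.mk' ℂ x (evalAdj m (coordFrame φ x) (σ x))) φ.source

/-- The semipositive `(n,n)`-form `|h_A^{1/m} · (σ ∧ σ̄)^{1/m}|`. -/
def sectionDensity (h : SmoothHermitianMetric n A) (m : ℕ) (σ : ∀ x, AdjFiber n A m x) :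
    Density n X := fun _ v =>
  h.sq (evalAdj m v (σ _)) ^ (1 / (m : ℝ))

/-- The extremal function `K̂_m^A`, a section of `|A|^{2/m} ⊗ |K_X|²`: the supremum of
`|σ|^{2/m}` over the global holomorphic sections `σ` of `A + m K_X` with
`|∫_X h_A^{1/m} · (σ ∧ σ̄)^{1/m}| = 1`.  It is given by its coefficients in `[0, ∞]` relative to
the frames `e` of local trivializations of `A`, on `n`-tuples of tangent vectors. -/
def Khat (h : SmoothHermitianMetric n A) (m : ℕ)
    (e : Trivialization ℂ (TotalSpace.proj : TotalSpace ℂ A → X)) (x : X)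
    (v : Fin n → Tan n x) : ℝ≥0∞ :=
  ⨆ (σ : ∀ x, AdjFiber n A m x) (_ : IsHolomorphicSection m σ)
    (_ : (sectionDensity h m σ).integral = 1),
    ‖(e ⟨x, evalAdj m v (σ x)⟩).2‖ₑ ^ (2 / (m : ℝ))

/-- The semipositive `(n,n)`-form `h_A^{1/m} · K̂_m^A`: at `x` it is `h_A(e, e)^{1/m}` times the
coefficient of `K̂_m^A` relative to `e`, for a local frame `e` of `A` around `x`. -/
def metricKhat (h : SmoothHermitianMetric n A) (m : ℕ) : Density n X := fun x v =>
  h.sq ((trivializationAt ℂ A x).symm x 1) ^ (1 / (m : ℝ)) *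
    Khat h m (trivializationAt ℂ A x) x v

/-- `K̂_∞^A = limsup_{m → ∞} h_A^{1/m} · K̂_m^A`. -/
def KhatInfty (h : SmoothHermitianMetric n A) : Density n X := fun x v =>
  limsup (fun m : ℕ => metricKhat h m x v) atTop

/-- The lower (semicontinuous) envelope of `(K̂_∞^A)⁻¹` in the chart `φ`: the weight
`ĥ_{can,A}(dz₁ ∧ ⋯ ∧ dzₙ, dz₁ ∧ ⋯ ∧ dzₙ)`.  The filter `𝓝 x` includes the point `x`, so the
`liminf` is the largest lower semicontinuous minorant. -/
def hcanWeight (h : SmoothHermitianMetric n A) (φ : OpenPartialHomeomorph X (Model n)) (x : X) :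
    ℝ≥0∞ :=
  liminf (fun y => ((KhatInfty h).coeff φ y)⁻¹) (𝓝 x)

/-- The singular hermitian metric `ĥ_{can,A}` on `K_X`, as the function
`ξ ↦ ĥ_{can,A}(ξ, ξ) ∈ [0, ∞]` on the fibres of `K_X`. -/
def hcan (h : SmoothHermitianMetric n A) (x : X) (ξ : CanFiber n x) : ℝ≥0∞ :=
  ‖ξ (coordFrame (chartAt (Model n) x) x)‖ₑ ^ 2 * hcanWeight h (chartAt (Model n) x) x

end LineBundle

end Supercanonical

end

namespace Supercanonical

/-! By compactness two smooth metrics satisfy `h ≤ C h'` and `h' ≤ D h` (`exists_sq_le_mul_sq`). At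
level `m` only their `m`-th roots enter, so the mass of a section changes by a factor at most
`C^(1/m)` or `D^(1/m)`. Renormalizing sections from one mass to the other (`Khat_le`) and comparing
the weights gives a pointwise bound with factor `(C D)^(1/m)` (`metricKhat_le`). This factor tends
to 1 and disappears in the limsup; exchanging the metrics gives equality. -/

/-- Every finite `r` is of the form `‖c‖ ^ p` with a complex number `c`. -/
theorem exists_enorm_rpow_eq {p : ℝ} (hp : 0 < p) {r : ℝ≥0∞} (hr : r ≠ ⊤) :
    ∃ c : ℂ, ‖c‖ₑ ^ p = r := by
  have hfin : r ^ (1 / p) ≠ ⊤ := ENNReal.rpow_ne_top_of_nonneg (by positivity) hr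
  refine ⟨((r ^ (1 / p)).toReal : ℂ), ?_⟩
  have : ‖((r ^ (1 / p)).toReal : ℂ)‖ₑ = r ^ (1 / p) := by
    rw [← ofReal_norm, Complex.norm_real, Real.norm_of_nonneg ENNReal.toReal_nonneg,
      ENNReal.ofReal_toReal hfin]
  rw [this, ← ENNReal.rpow_mul, one_div_mul_cancel hp.ne', ENNReal.rpow_one]

/-- Factors `C ^ (1 / m)` do not change an upper limit. -/
theorem limsup_rpow_one_div_mul_le {C : ℝ≥0∞} (h0 : C ≠ 0) (hC : C ≠ ⊤) (u : ℕ → ℝ≥0∞) :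
    limsup (fun m : ℕ => C ^ (1 / (m : ℝ)) * u m) atTop ≤ limsup u atTop := by
  have hlim : Tendsto (fun m : ℕ => C ^ (1 / (m : ℝ))) atTop (𝓝 1) := by
    lift C to NNReal using hC
    have h0' : C ≠ 0 := by simpa using h0
    have h1 : Tendsto (fun m : ℕ => C ^ (1 / (m : ℝ))) atTop (𝓝 1) := by
      -- Joint continuity of `rpow` at `(C, 0)`, which requires `C ≠ 0`.
      have := (NNReal.continuousAt_rpow (x := C) (y := 0) (Or.inl h0')).tendsto.comp
        (tendsto_const_nhds.prodMk_nhds tendsto_one_div_atTop_nhds_zero_nat)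
      simpa [Function.comp_def] using this
    have h2 := (ENNReal.continuous_coe.tendsto 1).comp h1
    refine (h2.congr fun m => ?_)
    simp [ENNReal.coe_rpow_of_ne_zero h0']
  have hl := hlim.limsup_eq
  have := ENNReal.limsup_mul_le' (f := atTop) (u := fun m : ℕ => C ^ (1 / (m : ℝ))) (v := u)
    (Or.inl (hl ▸ one_ne_zero)) (Or.inl (hl ▸ ENNReal.one_ne_top))
  rw [hl, one_mul] at this
  exact this

section Integral

variable {n : ℕ} {X : Type*} [TopologicalSpace X] [ChartedSpace (Model n) X]

theorem Density.integral_mono {η η' : Density n X} (hη : ∀ x v, η x v ≤ η' x v) :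
    η.integral ≤ η'.integral := by
  unfold Density.integral
  gcongr with N φ S _ _ i
  exact hη _ _

/-- A density need not be measurable; finiteness of `c` is what lets it leave each integral. -/
theorem Density.integral_const_mul {c : ℝ≥0∞} (hc : c ≠ ⊤) (η : Density n X) :
    Density.integral (fun x v => c * η x v) = c * η.integral := by
  unfold Density.integral Density.coeff
  simp only [ENNReal.mul_iSup, Finset.mul_sum]
  simp only [← lintegral_const_mul' c _ hc, mul_left_comm c]

end Integral

section Metric

variable {n : ℕ} {X : Type*} [TopologicalSpace X] [ChartedSpace (Model n) X]
  {A : X → Type*} [TopologicalSpace (TotalSpace ℂ A)] [∀ x, AddCommGroup (A x)]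
  [∀ x, Module ℂ (A x)] [∀ x, TopologicalSpace (A x)] [FiberBundle ℂ A]

theorem SmoothHermitianMetric.re_form_smul (h : SmoothHermitianMetric n A) {x : X} (c : ℂ)
    (a : A x) : (h.form x (c • a) (c • a)).re = ‖c‖ ^ 2 * (h.form x a a).re := by
  have : h.form x (c • a) (c • a) = ((‖c‖ ^ 2 : ℝ) : ℂ) * h.form x a a := by
    simp only [map_smulₛₗ, LinearMap.smul_apply, smul_eq_mul, RingHom.id_apply]
    rw [← mul_assoc, Complex.mul_conj, Complex.normSq_eq_norm_sq]
  rw [this, Complex.re_ofReal_mul]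

theorem SmoothHermitianMetric.sq_smul (h : SmoothHermitianMetric n A) {x : X} (c : ℂ)
    (a : A x) : h.sq (c • a) = ‖c‖ₑ ^ 2 * h.sq a := by
  rw [sq, sq, re_form_smul, ENNReal.ofReal_mul (by positivity),
    ENNReal.ofReal_pow (norm_nonneg _), ofReal_norm]

theorem sectionDensity_const_smul (h : SmoothHermitianMetric n A) (m : ℕ) (c : ℂ)
    (σ : ∀ x, AdjFiber n A m x) :
    sectionDensity h m (c • σ) = fun x v => ‖c‖ₑ ^ (2 / (m : ℝ)) * sectionDensity h m σ x v := by
  funext x v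
  rw [sectionDensity, sectionDensity, Pi.smul_apply, map_smul, h.sq_smul,
    ENNReal.mul_rpow_of_nonneg _ _ (by positivity), ← ENNReal.rpow_natCast, ← ENNReal.rpow_mul]
  congr 2
  push_cast
  ring

theorem sectionDensity_le {h h' : SmoothHermitianMetric n A} {C : ℝ≥0∞}
    (hC : ∀ x (a : A x), h.sq a ≤ C * h'.sq a) (m : ℕ) (σ : ∀ x, AdjFiber n A m x) (x : X)
    (v : Fin n → Tan n x) :
    sectionDensity h m σ x v ≤ C ^ (1 / (m : ℝ)) * sectionDensity h' m σ x v := by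
  rw [sectionDensity, sectionDensity, ← ENNReal.mul_rpow_of_nonneg _ _ (by positivity)]
  gcongr
  exact hC _ _

theorem integral_sectionDensity_le {h h' : SmoothHermitianMetric n A} {C : ℝ≥0∞} (hfin : C ≠ ⊤)
    (hC : ∀ x (a : A x), h.sq a ≤ C * h'.sq a) (m : ℕ) (σ : ∀ x, AdjFiber n A m x) :
    (sectionDensity h m σ).integral ≤ C ^ (1 / (m : ℝ)) * (sectionDensity h' m σ).integral := by
  rw [← Density.integral_const_mul (ENNReal.rpow_ne_top_of_nonneg (by positivity) hfin)]
  exact Density.integral_mono (sectionDensity_le hC m σ)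

variable [VectorBundle ℂ ℂ A]

theorem IsHolomorphicSection.const_smul
    [ContMDiffVectorBundle ω ℂ A 𝓘(ℂ, Model n)] {m : ℕ} {σ : ∀ x, AdjFiber n A m x}
    (hσ : IsHolomorphicSection m σ) (c : ℂ) : IsHolomorphicSection m (c • σ) := by
  intro φ hφ
  have := (hσ φ hφ).const_smul_section (a := c)
  refine this.congr fun x _ => ?_
  simp

/-- Two hermitian metrics on a line bundle over a compact base are comparable. -/
theorem exists_sq_le_mul_sq [CompactSpace X] (h h' : SmoothHermitianMetric n A) :
    ∃ C : ℝ≥0∞, C ≠ 0 ∧ C ≠ ⊤ ∧ ∀ x (a : A x), h.sq a ≤ C * h'.sq a := by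
  suffices H : ∃ C : ℝ≥0∞, C ≠ 0 ∧ C ≠ ⊤ ∧ ∀ x ∈ (Set.univ : Set X), ∀ a : A x,
      h.sq a ≤ C * h'.sq a by
    simpa using H
  -- Comparability passes to subsets and finite unions, so a local bound near each point suffices.
  refine isCompact_univ.induction_on
    (p := fun S => ∃ C : ℝ≥0∞, C ≠ 0 ∧ C ≠ ⊤ ∧ ∀ x ∈ S, ∀ a : A x, h.sq a ≤ C * h'.sq a)
    ⟨1, by simp⟩ ?_ ?_ ?_
  · rintro S T hST ⟨C, h0, hC, H⟩
    exact ⟨C, h0, hC, fun x hx => H x (hST hx)⟩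
  · rintro S T ⟨C, h0, hC, H⟩ ⟨D, _, hD, H'⟩
    refine ⟨C + D, by simp [h0], by simp [hC, hD], ?_⟩
    rintro x (hx | hx) a
    · exact (H x hx a).trans (by gcongr; exact le_self_add)
    · exact (H' x hx a).trans (by gcongr; exact le_add_self)
  · intro x₀ _
    set e := trivializationAt ℂ A x₀ with he
    have hx₀ : x₀ ∈ e.baseSet := FiberBundle.mem_baseSet_trivializationAt' x₀
    have hpos : ∀ (k : SmoothHermitianMetric n A), ∀ x ∈ e.baseSet,
        0 < (k.form x (e.symm x 1) (e.symm x 1)).re := fun k x hx => by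
      refine k.pos x _ fun h0 => one_ne_zero (α := ℂ) ?_
      have := (e.linearEquivAt ℂ x hx).apply_symm_apply (1 : ℂ)
      rw [e.linearEquivAt_symm_apply, h0, map_zero] at this
      exact this.symm
    have hcont : ∀ k : SmoothHermitianMetric n A,
        ContinuousAt (fun x => (k.form x (e.symm x 1) (e.symm x 1)).re) x₀ := fun k =>
      (k.smooth e).continuousOn.continuousAt (e.open_baseSet.mem_nhds hx₀)
    set q : X → ℝ := fun x =>
      (h.form x (e.symm x 1) (e.symm x 1)).re / (h'.form x (e.symm x 1) (e.symm x 1)).re with hq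
    have hqc : ContinuousAt q x₀ := (hcont h).div (hcont h') (hpos h' x₀ hx₀).ne'
    have hq0 : 0 < q x₀ := div_pos (hpos h x₀ hx₀) (hpos h' x₀ hx₀)
    -- The ratio `q` of the two weights in the frame is continuous at `x₀`, hence below `q x₀ + 1`
    -- nearby.
    refine ⟨{x | x ∈ e.baseSet ∧ q x < q x₀ + 1}, ?_, ENNReal.ofReal (q x₀ + 1), ?_,
      ENNReal.ofReal_ne_top, ?_⟩
    · rw [nhdsWithin_univ]
      exact (e.open_baseSet.eventually_mem hx₀).and
        (hqc.eventually_lt_const (lt_add_one _))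
    · simp only [ne_eq, ENNReal.ofReal_eq_zero, not_le]
      linarith
    · rintro x ⟨hx, hqx⟩ a
      -- Rank one: every vector is a multiple of the frame, so comparing the metrics on the frame is
      -- enough.
      have ha : a = (e ⟨x, a⟩).2 • e.symm x 1 := by
        have h1 := (e.linearEquivAt ℂ x hx).symm_apply_apply a
        rw [e.linearEquivAt_apply] at h1
        conv_lhs => rw [← h1]
        rw [← e.linearEquivAt_symm_apply (R := ℂ) x hx, ← map_smul, smul_eq_mul, mul_one]
      rw [ha, h.sq_smul, h'.sq_smul, mul_left_comm]
      gcongr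
      rw [SmoothHermitianMetric.sq, SmoothHermitianMetric.sq, ← ENNReal.ofReal_mul (by linarith)]
      exact ENNReal.ofReal_le_ofReal ((div_le_iff₀ (hpos h' x hx)).1 hqx.le)

variable [ContMDiffVectorBundle ω ℂ A 𝓘(ℂ, Model n)]

/-- A section of `h`-mass 1 has `h'`-mass `J ≤ D^(1/m)`; dividing by `J` makes it a competitor for
`h'`. The bound by `C` serves only to exclude `J = 0`. -/
theorem Khat_le {h h' : SmoothHermitianMetric n A} {C D : ℝ≥0∞} (hCfin : C ≠ ⊤) (hDfin : D ≠ ⊤)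
    (hC : ∀ x (a : A x), h.sq a ≤ C * h'.sq a) (hD : ∀ x (a : A x), h'.sq a ≤ D * h.sq a)
    {m : ℕ} (hm : 0 < m) (e : Trivialization ℂ (TotalSpace.proj : TotalSpace ℂ A → X))
    [MemTrivializationAtlas e] {x : X} (hx : x ∈ e.baseSet) (v : Fin n → Tan n x) :
    Khat h m e x v ≤ D ^ (1 / (m : ℝ)) * Khat h' m e x v := by
  have hm' : (0 : ℝ) < 2 / m := by positivity
  refine iSup_le fun σ => iSup_le fun hσ => iSup_le fun hint => ?_
  set J := (sectionDensity h' m σ).integral with hJ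
  have hJD : J ≤ D ^ (1 / (m : ℝ)) := by
    simpa [hint] using integral_sectionDensity_le hDfin hD m σ
  have hJtop : J ≠ ⊤ :=
    ne_top_of_le_ne_top (ENNReal.rpow_ne_top_of_nonneg (by positivity) hDfin) hJD
  have hJ0 : J ≠ 0 := fun h0 => by
    have := integral_sectionDensity_le hCfin hC m σ
    rw [hint, ← hJ, h0, mul_zero] at this
    simp at this
  -- Scaling `σ` by `c` multiplies both its mass and `|σ|^(2/m)` by `‖c‖^(2/m)`, chosen to be `J⁻¹`.
  obtain ⟨c, hc⟩ := exists_enorm_rpow_eq hm' (ENNReal.inv_ne_top.2 hJ0)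
  have hint' : (sectionDensity h' m (c • σ)).integral = 1 := by
    rw [sectionDensity_const_smul, hc, Density.integral_const_mul (ENNReal.inv_ne_top.2 hJ0),
      ENNReal.inv_mul_cancel hJ0 hJtop]
  have hle : ‖(e ⟨x, evalAdj m v ((c • σ) x)⟩).2‖ₑ ^ (2 / (m : ℝ)) ≤ Khat h' m e x v :=
    le_iSup_of_le (c • σ) (le_iSup_of_le (hσ.const_smul c) (le_iSup_of_le hint' le_rfl))
  have hlin : (e ⟨x, evalAdj m v ((c • σ) x)⟩).2 = c * (e ⟨x, evalAdj m v (σ x)⟩).2 := by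
    rw [Pi.smul_apply, map_smul, ← smul_eq_mul]
    exact (e.linear ℂ hx).map_smul c _
  rw [hlin, enorm_mul, ENNReal.mul_rpow_of_nonneg _ _ hm'.le, hc] at hle
  calc ‖(e ⟨x, evalAdj m v (σ x)⟩).2‖ₑ ^ (2 / (m : ℝ))
      = J * (J⁻¹ * ‖(e ⟨x, evalAdj m v (σ x)⟩).2‖ₑ ^ (2 / (m : ℝ))) := by
        rw [← mul_assoc, ENNReal.mul_inv_cancel hJ0 hJtop, one_mul]
    _ ≤ D ^ (1 / (m : ℝ)) * Khat h' m e x v := mul_le_mul' hJD hle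

/-- The weight contributes `C^(1/m)` and the extremal function `D^(1/m)`. -/
theorem metricKhat_le {h h' : SmoothHermitianMetric n A} {C D : ℝ≥0∞} (hCfin : C ≠ ⊤)
    (hDfin : D ≠ ⊤) (hC : ∀ x (a : A x), h.sq a ≤ C * h'.sq a)
    (hD : ∀ x (a : A x), h'.sq a ≤ D * h.sq a) {m : ℕ} (hm : 0 < m) (x : X)
    (v : Fin n → Tan n x) :
    metricKhat h m x v ≤ (C * D) ^ (1 / (m : ℝ)) * metricKhat h' m x v := by
  have hp : (0 : ℝ) ≤ 1 / m := by positivity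
  rw [metricKhat, metricKhat, ENNReal.mul_rpow_of_nonneg _ _ hp, mul_mul_mul_comm,
    ← ENNReal.mul_rpow_of_nonneg _ _ hp]
  refine mul_le_mul' (ENNReal.rpow_le_rpow (hC _ _) hp) ?_
  exact Khat_le hCfin hDfin hC hD hm _ (FiberBundle.mem_baseSet_trivializationAt' x) v

theorem KhatInfty_le [CompactSpace X] (h h' : SmoothHermitianMetric n A) (x : X)
    (v : Fin n → Tan n x) : KhatInfty h x v ≤ KhatInfty h' x v := by
  obtain ⟨C, hC0, hCfin, hC⟩ := exists_sq_le_mul_sq h h'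
  obtain ⟨D, hD0, hDfin, hD⟩ := exists_sq_le_mul_sq h' h
  refine (limsup_le_limsup ?_).trans
    (limsup_rpow_one_div_mul_le (mul_ne_zero hC0 hD0) (ENNReal.mul_ne_top hCfin hDfin) _)
  -- At `m = 0` the exponent `2 / m` is 0 by convention, so rescaling could not normalize the mass.
  filter_upwards [eventually_gt_atTop 0] with m hm
  exact metricKhat_le hCfin hDfin hC hD hm x v

end Metric

end Supercanonical

theorem theorem2p7 {n : ℕ} {X : Type*} [TopologicalSpace X] [T2Space X] [CompactSpace X]
    [ChartedSpace (Supercanonical.Model n) X]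
    [IsManifold 𝓘(ℂ, Supercanonical.Model n) ω X]
    (A : X → Type*) [TopologicalSpace (TotalSpace ℂ A)] [∀ x, AddCommGroup (A x)]
    [∀ x, Module ℂ (A x)] [∀ x, TopologicalSpace (A x)] [FiberBundle ℂ A]
    [VectorBundle ℂ ℂ A] [ContMDiffVectorBundle ω ℂ A 𝓘(ℂ, Supercanonical.Model n)]
    (h h' : Supercanonical.SmoothHermitianMetric n A) :
    Supercanonical.KhatInfty h = Supercanonical.KhatInfty h' ∧
      Supercanonical.hcan h = Supercanonical.hcan h' := by
  have key : Supercanonical.KhatInfty h = Supercanonical.KhatInfty h' :=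
    funext fun x => funext fun v => le_antisymm (Supercanonical.KhatInfty_le h h' x v)
      (Supercanonical.KhatInfty_le h' h x v)
  refine ⟨key, ?_⟩
  funext x ξ
  rw [Supercanonical.hcan, Supercanonical.hcan, Supercanonical.hcanWeight,
    Supercanonical.hcanWeight, key]
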